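/- Let $q\ge 2$ and let $\mathcal X$ be a homogeneous tree of degree $q+1$ (a connected graph without cycles in which every vertex has exactly $q+1$ neighbours), with graph distance $d$ and a fixed vertex $o$; write $|x|=d(o,x)$ and $B(o,n)=\{x:|x|\le n\}$. Let $\Omega$ be the boundary of $\mathcal X$, that is, the set of all infinite geodesic rays $\omega=\{\omega_0,\omega_1,\dots\}$ starting from $\omega_0=o$. For $x\in\mathcal X$ and $\omega\in\Omega$ let $c(x,\omega)$ be the last vertex of the geodesic path from $o$ to $x$ that lies on $\omega$, and put $E(x)=\{\omega\in\Omega:|c(x,\omega)|\ge|x|\}$. Equip $\Omega$ with the $\sigma$-algebra generated by the sets $E(x)$, $x\in\mathcal X$, and with the unique measure $\nu$ such that $\nu(E(o))=1$ and $\nu(E(x))=\frac{1}{(q+1)q^{|x|-1}}$ for $x\ne o$; it is a probability measure. Let $p(x,\omega)=q^{2|c(x,\omega)|-|x|}$ be the Poisson kernel, let $$\mathcal P_zF(x)=\int_\Omega p^{1/2+iz}(x,\omega)F(\omega)\,d\nu(\omega)$$ be the Poisson transform, let $\tau=2\pi/\log q$, and let $$\mathbf c(z)=\frac{q^{1/2}}{q+1}\,\frac{q^{1/2+iz}-q^{-1/2-iz}}{q^{iz}-q^{-iz}},\qquad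 z\in\mathbb C\setminus(\tau/2)\mathbb Z.$$ Let $z\in\mathbb R\setminus(\tau/2)\mathbb Z$, $1<r<\infty$, and let $F:\Omega\to\mathbb C$ belong to $L^r(\Omega,\nu)$. Then $p^{1/2+iz}(x,\cdot)F$ is $\nu$-integrable for every $x\in\mathcal X$ (so that $\mathcal P_zF$ is defined by an absolutely convergent integral), for every $n\ge 1$ the function $$T_nF(\omega)=\frac1n\sum_{x\in B(o,n)}p^{1/2-iz}(x,\omega)\,\mathcal P_zF(x)$$ belongs to $L^r(\Omega,\nu)$, and $$\lim_{n\to\infty}\left\|\frac{q}{2(q+1)|\mathbf c(z)|^2}\,T_nF-F\right\|_{L^r(\Omega,\nu)}=0.$$ -/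

import Mathlib

open MeasureTheory Filter Topology

namespace HomTree

/-- The graph `G` is a homogeneous tree of degree `q + 1` with `q ≥ 2`: it is connected, it has no
cycles and every vertex has exactly `q + 1` neighbours. -/
structure IsHomogeneousTree {X : Type*} (G : SimpleGraph X) [G.LocallyFinite] (q : ℕ) : Prop where
  two_le : 2 ≤ q
  isTree : G.IsTree
  regular : G.IsRegularOfDegree (q + 1)

/-- The boundary of the tree: all infinite geodesic rays `ω 0, ω 1, …` starting from `o`. -/
@[ext]
structure Boundary {X : Type*} (G : SimpleGraph X) (o : X) where
  vertex : ℕ → X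
  start : vertex 0 = o
  geodesic : ∀ m k : ℕ, G.dist (vertex m) (vertex (m + k)) = k

/-- The confluence point `c(x, ω)`: the last point lying on `ω` in the geodesic path from `o` to
`x`. (A vertex `y` lies on this path exactly if `d(o, y) + d(y, x) = d(o, x)`.) -/
noncomputable def confluence {X : Type*} {G : SimpleGraph X} {o : X} (x : X) (ω : Boundary G o) :
    X :=
  ω.vertex (sSup {n : ℕ | G.dist o (ω.vertex n) + G.dist (ω.vertex n) x = G.dist o x})

/-- The sector `E_j(x)` of all boundary points `ω` with `|c(x, ω)| ≥ j`. -/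
def sectorAt {X : Type*} (G : SimpleGraph X) (o x : X) (j : ℕ) : Set (Boundary G o) :=
  {ω | j ≤ G.dist o (confluence x ω)}

/-- The sector `E(x) = E_{|x|}(x)`. -/
def sector {X : Type*} (G : SimpleGraph X) (o x : X) : Set (Boundary G o) :=
  sectorAt G o x (G.dist o x)

/-- The σ-algebra on the boundary is generated by the sectors `E(x)`. -/
instance {X : Type*} (G : SimpleGraph X) (o : X) : MeasurableSpace (Boundary G o) :=
  MeasurableSpace.generateFrom (Set.range (sector G o))

section Existence

variable {X : Type*} {G : SimpleGraph X} {o : X}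

theorem dist_ray (ω : Boundary G o) (n : ℕ) : G.dist o (ω.vertex n) = n := by
  have h := ω.geodesic 0 n
  rwa [zero_add, ω.start] at h

theorem mem_sector (hG : G.Connected) (x : X) (ω : Boundary G o) :
    ω ∈ sector G o x ↔ ω.vertex (G.dist o x) = x := by
  unfold sector sectorAt confluence
  rw [Set.mem_ofPred_eq, dist_ray]
  have hb : ∀ n ∈ {n : ℕ | G.dist o (ω.vertex n) + G.dist (ω.vertex n) x = G.dist o x}, n ≤ G.dist o x := by
    intro n hn
    rw [Set.mem_ofPred_eq, dist_ray] at hn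
    omega
  have hne : {n : ℕ | G.dist o (ω.vertex n) + G.dist (ω.vertex n) x = G.dist o x}.Nonempty :=
    ⟨0, by simp [ω.start]⟩
  have hbd : BddAbove {n : ℕ | G.dist o (ω.vertex n) + G.dist (ω.vertex n) x = G.dist o x} := ⟨_, hb⟩
  constructor
  · intro h
    have hm := Nat.sSup_mem hne hbd
    have he := le_antisymm (hb _ hm) h
    rw [he, Set.mem_ofPred_eq, dist_ray] at hm
    exact hG.dist_eq_zero_iff.1 (by omega)
  · intro h
    apply le_csSup hbd
    rw [Set.mem_ofPred_eq, h]
    simp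

theorem parent_unique (hG : G.IsTree) {x y y' : X} (h : G.Adj y x) (h' : G.Adj y' x)
    (hd : G.dist o x = G.dist o y + 1) (hd' : G.dist o x = G.dist o y' + 1) : y = y' := by
  obtain ⟨p, -, hp⟩ := hG.connected.exists_path_of_dist o y
  obtain ⟨p', -, hp'⟩ := hG.connected.exists_path_of_dist o y'
  have h1 : (p.concat h).IsPath :=
    SimpleGraph.Walk.isPath_of_length_eq_dist _ (by simp [hp, hd])
  have h2 : (p'.concat h').IsPath :=
    SimpleGraph.Walk.isPath_of_length_eq_dist _ (by simp [hp', hd'])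
  have h3 := congrArg SimpleGraph.Walk.penultimate ((hG.existsUnique_path o x).unique h1 h2)
  simpa using h3

theorem exists_geodesic (hG : G.Connected) (o x : X) : ∃ a : ℕ → X, a 0 = o ∧ a (G.dist o x) = x ∧
    (∀ i < G.dist o x, G.Adj (a i) (a (i + 1))) ∧ ∀ i ≤ G.dist o x, G.dist o (a i) = i := by
  obtain ⟨p, -, hp⟩ := hG.exists_path_of_dist o x
  have hadj : ∀ i < G.dist o x, G.Adj (p.getVert i) (p.getVert (i + 1)) :=
    fun i hi => p.adj_getVert_succ (by omega)
  have hstep : ∀ i < G.dist o x, G.dist o (p.getVert (i + 1)) ≤ G.dist o (p.getVert i) + 1 := by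
    intro i hi
    have := hG.dist_triangle (u := o) (v := p.getVert i) (w := p.getVert (i + 1))
    rwa [SimpleGraph.dist_eq_one_iff_adj.2 (hadj i hi)] at this
  have hle : ∀ i ≤ G.dist o x, G.dist o (p.getVert i) ≤ i := by
    intro i
    induction i with
    | zero => simp
    | succ i ih =>
      intro hi
      have := hstep i (by omega)
      have := ih (by omega)
      omega
  have hge : ∀ k ≤ G.dist o x, G.dist o x ≤ G.dist o (p.getVert (G.dist o x - k)) + k := by
    intro k
    induction k with
    | zero =>
      intro _
      have : p.getVert (G.dist o x) = x := by rw [← hp]; simp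
      simp [this]
    | succ k ih =>
      intro hk
      have h1 := ih (by omega)
      have h2 := hstep (G.dist o x - (k + 1)) (by omega)
      rw [show G.dist o x - (k + 1) + 1 = G.dist o x - k by omega] at h2
      omega
  refine ⟨p.getVert, by simp, by rw [← hp]; simp, hadj, fun i hi => ?_⟩
  have h1 := hle i hi
  have h2 := hge (G.dist o x - i) (by omega)
  rw [show G.dist o x - (G.dist o x - i) = i by omega] at h2
  omega

/-- The neighbours of `x` that are further away from `o` than `x`. -/
@[ext]
structure Child (G : SimpleGraph X) (o x : X) where
  vertex : X
  adj : G.Adj x vertex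
  dist_eq : G.dist o vertex = G.dist o x + 1

instance (x : X) : MeasurableSpace (Child G o x) := ⊤

open Classical in
theorem card_child [G.LocallyFinite] {q : ℕ} (hT : IsHomogeneousTree G q) (x : X) :
    Nat.card (Child G o x) = if x = o then q + 1 else q := by
  have hc : Nat.card (Child G o x) =
      ((G.neighborFinset x).filter (fun y => G.dist o y = G.dist o x + 1)).card :=
    (Nat.card_congr ⟨fun c => ⟨c.vertex, c.adj, c.dist_eq⟩, fun c => ⟨c.1, c.2.1, c.2.2⟩,
      fun _ => rfl, fun _ => rfl⟩).trans
      (Nat.subtype_card (p := fun y => G.Adj x y ∧ G.dist o y = G.dist o x + 1) _ (by simp))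
  have hq : (G.neighborFinset x).card = q + 1 := hT.regular x
  rw [hc]
  split_ifs with h
  · rw [← hq]
    congr 1
    rw [Finset.filter_eq_self]
    intro y hy
    rw [SimpleGraph.mem_neighborFinset] at hy
    subst h
    rw [SimpleGraph.dist_eq_one_iff_adj.2 hy]
    simp
  · obtain ⟨a, ha0, hax, hadj, hd⟩ := exists_geodesic hT.isTree.connected o x
    have hpos := hT.isTree.connected.pos_dist_of_ne (Ne.symm h)
    have h1 := hadj (G.dist o x - 1) (by omega)
    have h2 := hd (G.dist o x - 1) (by omega)
    rw [show G.dist o x - 1 + 1 = G.dist o x by omega, hax] at h1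
    have he : (G.neighborFinset x).filter (fun y => G.dist o y = G.dist o x + 1) =
        (G.neighborFinset x).erase (a (G.dist o x - 1)) := by
      ext y
      rw [Finset.mem_filter, Finset.mem_erase, SimpleGraph.mem_neighborFinset]
      constructor
      · rintro ⟨hy, hy'⟩
        refine ⟨?_, hy⟩
        rintro rfl
        omega
      · rintro ⟨hy, hy'⟩
        refine ⟨hy', ?_⟩
        rcases hT.isTree.dist_eq_dist_add_one_of_adj o hy' with h3 | h3
        · exact absurd (parent_unique hT.isTree hy'.symm h1 h3 (by omega)) hy
        · exact h3
    rw [he, Finset.card_erase_of_mem (by rw [SimpleGraph.mem_neighborFinset]; exact h1.symm), hq]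
    rfl

/-- The sequence of vertices starting at `o` and moving from each vertex `x` to the child `s x`. -/
def follow (o : X) (s : ∀ x, Child G o x) : ℕ → X
  | 0 => o
  | n + 1 => (s (follow o s n)).vertex

theorem dist_follow (s : ∀ x, Child G o x) (n : ℕ) : G.dist o (follow o s n) = n := by
  induction n with
  | zero => simp [follow]
  | succ n ih => rw [follow, (s _).dist_eq, ih]

theorem dist_follow_add (hG : G.Connected) (s : ∀ x, Child G o x) (m k : ℕ) :
    G.dist (follow o s m) (follow o s (m + k)) = k := by
  apply le_antisymm
  · induction k with
    | zero => simp
    | succ k ih =>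
      refine (hG.dist_triangle (v := follow o s (m + k))).trans ?_
      have : G.dist (follow o s (m + k)) (follow o s (m + (k + 1))) = 1 :=
        SimpleGraph.dist_eq_one_iff_adj.2 (s (follow o s (m + k))).adj
      omega
  · have h := hG.dist_triangle (u := o) (v := follow o s m) (w := follow o s (m + k))
    rw [dist_follow, dist_follow] at h
    omega

open Classical in
theorem follow_eq_pi (hG : G.IsTree) (o x : X) (a : ℕ → X) (ha0 : a 0 = o)
    (hax : a (G.dist o x) = x) (hadj : ∀ i < G.dist o x, G.Adj (a i) (a (i + 1)))
    (hd : ∀ i ≤ G.dist o x, G.dist o (a i) = i) :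
    {s : ∀ x, Child G o x | follow o s (G.dist o x) = x} =
      Set.pi (((Finset.range (G.dist o x)).image a : Finset X) : Set X)
        (fun y => {c : Child G o y | ∀ i < G.dist o x, a i = y → c.vertex = a (i + 1)}) := by
  ext s
  simp only [Set.mem_ofPred_eq, Set.mem_pi, Finset.coe_image, Finset.coe_range, Set.mem_image,
    Set.mem_Iio]
  constructor
  · intro h
    have hback : ∀ k ≤ G.dist o x, follow o s (G.dist o x - k) = a (G.dist o x - k) := by
      intro k
      induction k with
      | zero => intro _; simpa [hax] using h
      | succ k ih =>
        intro hk
        have h1 := ih (by omega)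
        have e : G.dist o x - k = G.dist o x - (k + 1) + 1 := by omega
        have h2 := And.intro (s (follow o s (G.dist o x - (k + 1)))).adj
          (s (follow o s (G.dist o x - (k + 1)))).dist_eq
        change G.Adj _ (follow o s (G.dist o x - (k + 1) + 1)) ∧
          G.dist o (follow o s (G.dist o x - (k + 1) + 1)) = _ at h2
        rw [e] at h1
        rw [h1] at h2
        have h3 := hadj (G.dist o x - (k + 1)) (by omega)
        refine parent_unique hG h2.1 h3 h2.2 ?_
        rw [hd _ (by omega), hd _ (by omega)]
    have hall : ∀ i ≤ G.dist o x, follow o s i = a i := by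
      intro i hi
      have := hback (G.dist o x - i) (by omega)
      rwa [show G.dist o x - (G.dist o x - i) = i by omega] at this
    rintro y - i hi rfl
    rw [← hall (i + 1) hi, ← hall i hi.le]
    rfl
  · intro h
    have hall : ∀ i ≤ G.dist o x, follow o s i = a i := by
      intro i
      induction i with
      | zero => intro _; exact ha0.symm
      | succ i ih =>
        intro hi
        rw [follow, ih (by omega)]
        exact h (a i) ⟨i, hi, rfl⟩ i hi rfl
    rw [hall _ le_rfl, hax]

theorem sector_self (hG : G.Connected) (o : X) : sector G o o = Set.univ := by
  ext ω
  rw [mem_sector hG]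
  simp [ω.start]

theorem ray_agree (hG : G.IsTree) (ω ω' : Boundary G o) {m n : ℕ} (hmn : m ≤ n)
    (h : ω.vertex n = ω'.vertex n) : ω.vertex m = ω'.vertex m := by
  induction n, hmn using Nat.le_induction with
  | base => exact h
  | succ n hn ih =>
    apply ih
    have h1 := SimpleGraph.dist_eq_one_iff_adj.1 (ω.geodesic n 1)
    have h2 := SimpleGraph.dist_eq_one_iff_adj.1 (ω'.geodesic n 1)
    rw [← h] at h2
    refine parent_unique (o := o) hG h1 h2 ?_ ?_ <;> rw [dist_ray, dist_ray]

theorem isPiSystem_sector (hG : G.IsTree) (o : X) :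
    IsPiSystem (Set.range (sector G o)) := by
  have key : ∀ x y : X, G.dist o x ≤ G.dist o y → (sector G o x ∩ sector G o y).Nonempty →
      sector G o y ⊆ sector G o x := by
    rintro x y hxy ⟨ω, hx, hy⟩ ω' hy'
    rw [mem_sector hG.connected] at hx hy hy' ⊢
    rw [← ray_agree hG ω ω' hxy (hy.trans hy'.symm), hx]
  rintro _ ⟨x, rfl⟩ _ ⟨y, rfl⟩ hne
  rcases le_total (G.dist o x) (G.dist o y) with h | h
  · exact ⟨y, (Set.inter_eq_right.2 (key x y h hne)).symm⟩
  · exact ⟨x, (Set.inter_eq_left.2 (key y x h (by rwa [Set.inter_comm]))).symm⟩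

/-- There is exactly one measure on the boundary with the prescribed values on the sectors. -/
theorem existsUnique_boundaryMeasure [G.LocallyFinite] {q : ℕ} (hT : IsHomogeneousTree G q)
    (o : X) : ∃! ν : Measure (Boundary G o), ν (sector G o o) = 1 ∧
      ∀ x, x ≠ o → ν (sector G o x) = 1 / (((q : ENNReal) + 1) * (q : ENNReal) ^ (G.dist o x - 1)) := by
  classical
  have hG := hT.isTree.connected
  have hcard := card_child (o := o) hT
  have hq := hT.two_le
  have hfin : ∀ x, Finite (Child G o x) := fun x =>
    Nat.finite_of_card_ne_zero (by rw [hcard]; split_ifs <;> omega)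
  have hne : ∀ x, Nonempty (Child G o x) := fun x =>
    (Nat.card_ne_zero.1 (by rw [hcard]; split_ifs <;> omega)).1
  have hms : ∀ x, MeasurableSingletonClass (Child G o x) := fun x => ⟨fun _ => trivial⟩
  let μ : ∀ x, Measure (Child G o x) := fun x => ProbabilityTheory.uniformOn Set.univ
  have hμ : ∀ x, IsProbabilityMeasure (μ x) := fun x =>
    ProbabilityTheory.isProbabilityMeasure_uniformOn Set.finite_univ Set.univ_nonempty
  have hμ1 : ∀ x (c : Child G o x), μ x {c} = 1 / ((if x = o then q + 1 else q : ℕ) : ENNReal) := by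
    intro x c
    have := Fintype.ofFinite (Child G o x)
    rw [← hcard, Nat.card_eq_fintype_card]
    simp [μ, ProbabilityTheory.uniformOn_univ]
  let R : (∀ x, Child G o x) → Boundary G o := fun s => ⟨follow o s, rfl, dist_follow_add hG s⟩
  have hpre : ∀ x, R ⁻¹' (sector G o x) =
      {s : ∀ x, Child G o x | follow o s (G.dist o x) = x} := by
    intro x
    ext s
    rw [Set.mem_preimage, mem_sector hG]
    rfl
  have hR : Measurable R := by
    apply measurable_generateFrom
    rintro _ ⟨x, rfl⟩
    obtain ⟨a, ha0, hax, hadj, hd⟩ := exists_geodesic hG o x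
    rw [hpre, follow_eq_pi hT.isTree o x a ha0 hax hadj hd]
    exact MeasurableSet.pi (Finset.countable_toSet _) fun _ _ => trivial
  have hval : ∀ x, ((Measure.infinitePi μ).map R) (sector G o x) =
      ∏ i ∈ Finset.range (G.dist o x), 1 / ((if i = 0 then q + 1 else q : ℕ) : ENNReal) := by
    intro x
    obtain ⟨a, ha0, hax, hadj, hd⟩ := exists_geodesic hG o x
    have hinj : ∀ i ≤ G.dist o x, ∀ j ≤ G.dist o x, a i = a j → i = j := by
      intro i hi j hj hij
      rw [← hd i hi, ← hd j hj, hij]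
    rw [Measure.map_apply hR (MeasurableSpace.measurableSet_generateFrom ⟨x, rfl⟩), hpre,
      follow_eq_pi hT.isTree o x a ha0 hax hadj hd,
      Measure.infinitePi_pi _ (fun _ _ => MeasurableSpace.measurableSet_top), Finset.prod_image]
    · apply Finset.prod_congr rfl
      intro i hi
      rw [Finset.mem_range] at hi
      have hset : {c : Child G o (a i) | ∀ j < G.dist o x, a j = a i → c.vertex = a (j + 1)} =
          {⟨a (i + 1), hadj i hi, by rw [hd _ hi, hd _ hi.le]⟩} := by
        ext c
        rw [Set.mem_ofPred_eq, Set.mem_singleton_iff]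
        constructor
        · intro h
          exact Child.ext (h i hi rfl)
        · rintro rfl j hj hji
          rw [hinj j hj.le i hi.le hji]
      have hio : a i = o ↔ i = 0 := by
        constructor
        · intro h
          have := hd i hi.le
          rw [h] at this
          simpa using this.symm
        · rintro rfl
          exact ha0
      rw [hset, hμ1]
      simp only [hio]
    · intro i hi j hj hij
      rw [Finset.coe_range, Set.mem_Iio] at hi hj
      exact hinj i hi.le j hj.le hij
  refine ⟨(Measure.infinitePi μ).map R, ⟨?_, ?_⟩, ?_⟩
  · rw [hval]
    simp
  · intro x hx
    have hpos := hG.pos_dist_of_ne (Ne.symm hx)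
    obtain ⟨n, hn⟩ : ∃ n, G.dist o x = n + 1 := ⟨G.dist o x - 1, by omega⟩
    rw [hval, hn, Finset.prod_range_succ']
    simp only [Nat.add_eq_zero_iff, one_ne_zero, and_false, if_false, if_true, Finset.prod_const,
      Finset.card_range, Nat.add_sub_cancel, one_div, Nat.cast_add, Nat.cast_one]
    rw [ENNReal.mul_inv (Or.inl (by simp)) (Or.inl (by finiteness)), ENNReal.inv_pow, mul_comm]
  · rintro ν ⟨h1, h2⟩
    have hfν : IsFiniteMeasure ν := ⟨by rw [← sector_self hG o, h1]; simp⟩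
    have hfin' : ∀ x, ν (sector G o x) = ((Measure.infinitePi μ).map R) (sector G o x) := by
      intro x
      by_cases hx : x = o
      · subst hx
        rw [h1, hval]
        simp
      · have hpos := hG.pos_dist_of_ne (Ne.symm hx)
        obtain ⟨n, hn⟩ : ∃ n, G.dist o x = n + 1 := ⟨G.dist o x - 1, by omega⟩
        rw [h2 x hx, hval, hn, Finset.prod_range_succ']
        simp only [Nat.add_eq_zero_iff, one_ne_zero, and_false, if_false, if_true,
          Finset.prod_const, Finset.card_range, Nat.add_sub_cancel, one_div, Nat.cast_add,
          Nat.cast_one]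
        rw [ENNReal.mul_inv (Or.inl (by simp)) (Or.inl (by finiteness)), ENNReal.inv_pow, mul_comm]
    refine ext_of_generate_finite _ rfl (isPiSystem_sector hT.isTree o) ?_ ?_
    · rintro _ ⟨x, rfl⟩
      exact hfin' x
    · rw [← sector_self hG o]
      exact hfin' o

theorem finite_ball [G.LocallyFinite] (hG : G.Connected) (o : X) (n : ℕ) :
    {x | G.dist o x ≤ n}.Finite := by
  induction n with
  | zero =>
    refine (Set.finite_singleton o).subset fun x hx => ?_
    exact (hG.dist_eq_zero_iff.1 (Nat.le_zero.1 hx)).symm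
  | succ n ih =>
    refine (ih.union (ih.biUnion fun y _ => (G.neighborFinset y).finite_toSet)).subset fun x hx => ?_
    by_cases h : G.dist o x ≤ n
    · exact Or.inl h
    · right
      obtain ⟨a, -, hax, hadj, hd⟩ := exists_geodesic hG o x
      have hx' : G.dist o x = n + 1 := le_antisymm hx (by omega)
      rw [hx'] at hadj hd hax
      have h1 := hadj n (by omega)
      rw [hax] at h1
      refine Set.mem_biUnion (x := a n) ?_ ?_
      · exact (hd n (by omega)).le
      · simpa using h1

end Existence

/-- The Poisson kernel `p(x, ω) = q ^ (2 |c(x, ω)| - |x|)`. -/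
noncomputable def poissonKernel {X : Type*} {G : SimpleGraph X} {o : X} (q : ℕ) (x : X)
    (ω : Boundary G o) : ℝ :=
  (q : ℝ) ^ (2 * (G.dist o (confluence x ω) : ℤ) - (G.dist o x : ℤ))

section PoissonTransform

variable {X : Type*} {G : SimpleGraph X} [G.LocallyFinite] {q : ℕ}

/-- The probability measure `ν` on the boundary: the unique measure with `ν (E(o)) = 1` and
`ν (E(x)) = 1 / ((q + 1) q ^ (|x| - 1))` for `x ≠ o`. -/
noncomputable def boundaryMeasure (hT : IsHomogeneousTree G q) (o : X) : Measure (Boundary G o) :=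
  (existsUnique_boundaryMeasure hT o).choose

theorem boundaryMeasure_sector_self (hT : IsHomogeneousTree G q) (o : X) :
    boundaryMeasure hT o (sector G o o) = 1 :=
  (existsUnique_boundaryMeasure hT o).choose_spec.1.1

theorem boundaryMeasure_sector (hT : IsHomogeneousTree G q) (o : X) {x : X} (hx : x ≠ o) :
    boundaryMeasure hT o (sector G o x) =
      1 / (((q : ENNReal) + 1) * (q : ENNReal) ^ (G.dist o x - 1)) :=
  (existsUnique_boundaryMeasure hT o).choose_spec.1.2 x hx

/-- The closed ball `B(o, n)`, a finite set of vertices. -/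
noncomputable def treeBall (hT : IsHomogeneousTree G q) (o : X) (n : ℕ) : Finset X :=
  (finite_ball hT.isTree.connected o n).toFinset

/-- The Poisson transform `P_z F (x) = ∫ p(x, ω) ^ (1/2 + i z) F(ω) dν(ω)`. -/
noncomputable def poissonTransform (hT : IsHomogeneousTree G q) {o : X} (z : ℂ)
    (F : Boundary G o → ℂ) (x : X) : ℂ :=
  ∫ ω, (poissonKernel q x ω : ℂ) ^ (1 / 2 + Complex.I * z) * F ω ∂(boundaryMeasure hT o)

/-- The averages `(1 / n) ∑_{x ∈ B(o, n)} p(x, ω) ^ (1/2 - i z) P_z F (x)`. -/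
noncomputable def poissonAverage (hT : IsHomogeneousTree G q) {o : X} (z : ℂ)
    (F : Boundary G o → ℂ) (n : ℕ) (ω : Boundary G o) : ℂ :=
  (1 / (n : ℂ)) * ∑ x ∈ treeBall hT o n,
    (poissonKernel q x ω : ℂ) ^ (1 / 2 - Complex.I * z) * poissonTransform hT z F x

end PoissonTransform

/-- The Harish-Chandra `c`-function of the homogeneous tree of degree `q + 1`. -/
noncomputable def cFunction (q : ℕ) (z : ℂ) : ℂ :=
  (q : ℂ) ^ (1 / 2 : ℂ) / ((q : ℂ) + 1) *
    (((q : ℂ) ^ (1 / 2 + Complex.I * z) - (q : ℂ) ^ (-(1 / 2) - Complex.I * z)) /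
      ((q : ℂ) ^ (Complex.I * z) - (q : ℂ) ^ (-(Complex.I * z))))

/-- The period `τ = 2π / log q`. -/
noncomputable def period (q : ℕ) : ℝ := 2 * Real.pi / Real.log q

end HomTree

/-! Write `w = q^{2iz}`, so `|w| = 1`, and `w ≠ 1` because `z ∉ (τ/2)ℤ`. Let `E_j F` be the
conditional expectation of `F` given the `j`-th vertex of the ray, that is, the average of `F` over
the sector of `ω_j`.

Along a ray, `p^s(ω_m, ω')` depends only on the depth of the confluence point, so it is a
combination of indicators of nested sectors. Hence `P_z F(ω_m)` equals `q^{-m(1/2+iz)}` times a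
combination of `E_0 F, …, E_m F` with coefficients `levelCoeff q w`
(`integral_poissonKernel_cpow_mul`). A sum over a sphere is a rescaled integral over the boundary,
and the kernel is symmetric in the two rays. Summing `p^{1/2-iz} P_z F` over the sphere of radius
`m` is therefore a second Poisson integral, and the tower property gives a double sum of
`E_{min(j,k)} F` over `j, k ≤ m` (`sum_treeSphere_poisson`).

The rest is summation by parts in a normed space (`sum_sum_levelCoeff_smul`): the double sum equals
`|c(z)|²` times `2 E_m F` minus two convolutions of the martingale differences with powers of `w`
and of `w⁻¹`. By Lévy's theorem `E_m F → F` in `L^r`, so the differences tend to `0`. The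
convolutions need not be small themselves, but since `w ≠ 1` their Cesàro means vanish
(`tendsto_average_geomConv`). The averages of the double sums thus tend to `2 |c(z)|² F`, and the
sphere normalisation contributes the factor `(q+1)/q`. -/

namespace HomTree

/-! ### Lévy's upward theorem in `L^r` -/

/-- Bounded almost everywhere convergence implies convergence in `L^r`. -/
theorem tendsto_eLpNorm_of_bounded_of_tendsto_ae {Ω : Type*} [MeasurableSpace Ω] {μ : Measure Ω}
    [IsFiniteMeasure μ] {r : ENNReal} (hr : 1 ≤ r) (hr' : r ≠ ⊤) {g : ℕ → Ω → ℝ} {f : Ω → ℝ}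
    (hg : ∀ n, AEStronglyMeasurable (g n) μ) (hf : AEStronglyMeasurable f μ) {c : ℝ}
    (hgc : ∀ n, ∀ᵐ x ∂μ, ‖g n x‖ ≤ c) (hfc : ∀ᵐ x ∂μ, ‖f x‖ ≤ c)
    (h : ∀ᵐ x ∂μ, Tendsto (fun n => g n x) atTop (𝓝 (f x))) :
    Tendsto (fun n => eLpNorm (g n - f) r μ) atTop (𝓝 0) := by
  have h0 : r ≠ 0 := (zero_lt_one.trans_le hr).ne'
  have hpos : 0 < r.toReal := ENNReal.toReal_pos h0 hr'
  have key : Tendsto (fun n => ∫⁻ x, ‖(g n - f) x‖ₑ ^ r.toReal ∂μ) atTop (𝓝 (∫⁻ _, 0 ∂μ)) := by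
    refine tendsto_lintegral_of_dominated_convergence'
      (fun _ => ENNReal.ofReal (2 * c) ^ r.toReal) ?_ ?_ ?_ ?_
    · exact fun n => (((hg n).sub hf).enorm.pow_const _)
    · intro n
      filter_upwards [hgc n, hfc] with x h1 h2
      gcongr
      rw [← ofReal_norm]
      gcongr
      exact (norm_sub_le _ _).trans (by linarith)
    · rw [lintegral_const]
      exact ENNReal.mul_ne_top (by finiteness) (by finiteness)
    · filter_upwards [h] with x hx
      have h1 : Tendsto (fun n => ‖g n x - f x‖ₑ ^ r.toReal) atTop (𝓝 (‖f x - f x‖ₑ ^ r.toReal)) :=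
        (ENNReal.continuous_rpow_const.tendsto _).comp (hx.sub_const _).enorm
      simpa [hpos] using h1
  rw [lintegral_zero] at key
  have h2 := (ENNReal.continuous_rpow_const (y := 1 / r.toReal)).tendsto 0 |>.comp key
  rw [ENNReal.zero_rpow_of_pos (by positivity)] at h2
  refine h2.congr fun n => ?_
  rw [eLpNorm_eq_lintegral_rpow_enorm_toReal h0 hr']
  rfl

/-- Lévy's upward theorem in `L^r`, for real-valued functions. -/
theorem tendsto_eLpNorm_condExp_sub_real {Ω : Type*} {m0 : MeasurableSpace Ω} {μ : Measure Ω}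
    [IsFiniteMeasure μ] (ℱ : Filtration ℕ m0) (hsup : ⨆ n, ℱ n = m0) {r : ENNReal} (hr : 1 ≤ r)
    (hr' : r ≠ ⊤) {F : Ω → ℝ} (hF : MemLp F r μ) :
    Tendsto (fun n => eLpNorm (μ[F | ℱ n] - F) r μ) atTop (𝓝 0) := by
  rw [ENNReal.tendsto_nhds_zero]
  intro ε hε
  by_cases hεt : ε = ⊤
  · simp [hεt]
  have hε3 : ε / 3 ≠ 0 := (ENNReal.div_pos hε.ne' (by simp)).ne'
  -- A bounded approximant `s` reduces the claim to a.e. convergence with a uniform bound. The error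
  -- `F - s` is harmless because conditional expectation is an `L^r` contraction.
  obtain ⟨s, hs, hsL⟩ := hF.exists_simpleFunc_eLpNorm_sub_lt hr' hε3
  obtain ⟨c, hc⟩ := s.exists_forall_norm_le
  have hsint : Integrable s μ := hsL.integrable hr
  have hae : ∀ᵐ x ∂μ, Tendsto (fun n => (μ[s | ℱ n]) x) atTop (𝓝 (s x)) := by
    refine hsint.tendsto_ae_condExp (ℱ := ℱ) ?_
    rw [hsup]
    exact s.stronglyMeasurable
  have hb := tendsto_eLpNorm_of_bounded_of_tendsto_ae hr hr'
    (fun n => (integrable_condExp (m := ℱ n) (f := s)).1) hsint.1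
    (fun n => ae_bdd_norm_condExp_of_ae_bdd_norm (m := ℱ n) (ae_of_all μ hc)) (ae_of_all μ hc) hae
  rw [ENNReal.tendsto_nhds_zero] at hb
  filter_upwards [hb (ε / 3) (pos_iff_ne_zero.2 hε3)] with n hn
  have hFint : Integrable F μ := hF.integrable hr
  have e : μ[F | ℱ n] - F =ᵐ[μ] μ[F - ⇑s | ℱ n] + (μ[s | ℱ n] - ⇑s) - (F - ⇑s) := by
    filter_upwards [condExp_sub hFint hsint (ℱ n)] with x hx
    simp only [Pi.sub_apply, Pi.add_apply] at hx ⊢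
    rw [hx]
    ring
  have m1 : AEStronglyMeasurable (μ[F - ⇑s | ℱ n]) μ := integrable_condExp.1
  have m2 : AEStronglyMeasurable (μ[s | ℱ n] - ⇑s) μ := integrable_condExp.1.sub hsint.1
  have m3 : AEStronglyMeasurable (F - ⇑s) μ := hF.1.sub hsint.1
  calc eLpNorm (μ[F | ℱ n] - F) r μ
      = eLpNorm (μ[F - ⇑s | ℱ n] + (μ[s | ℱ n] - ⇑s) - (F - ⇑s)) r μ := eLpNorm_congr_ae e
    _ ≤ eLpNorm (μ[F - ⇑s | ℱ n]) r μ + eLpNorm (μ[s | ℱ n] - ⇑s) r μ + eLpNorm (F - ⇑s) r μ :=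
        (eLpNorm_sub_le (m1.add m2) m3 hr).trans (by gcongr; exact eLpNorm_add_le m1 m2 hr)
    _ ≤ ε / 3 + ε / 3 + ε / 3 := by
        gcongr
        exact (eLpNorm_condExp_le_eLpNorm _ hr).trans hs.le
    _ = ε := ENNReal.add_thirds ε

/-- Lévy's upward theorem in `L^r`, for complex-valued functions. -/
theorem tendsto_eLpNorm_condExp_sub {Ω : Type*} {m0 : MeasurableSpace Ω} {μ : Measure Ω}
    [IsFiniteMeasure μ] (ℱ : Filtration ℕ m0) (hsup : ⨆ n, ℱ n = m0) {r : ENNReal} (hr : 1 ≤ r)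
    (hr' : r ≠ ⊤) {F : Ω → ℂ} (hF : MemLp F r μ) :
    Tendsto (fun n => eLpNorm (μ[F | ℱ n] - F) r μ) atTop (𝓝 0) := by
  have hFint : Integrable F μ := hF.integrable hr
  have h1 := tendsto_eLpNorm_condExp_sub_real ℱ hsup hr hr' hF.re
  have h2 := tendsto_eLpNorm_condExp_sub_real ℱ hsup hr hr' hF.im
  have h3 := h1.add h2
  rw [add_zero] at h3
  refine tendsto_of_tendsto_of_tendsto_of_le_of_le tendsto_const_nhds h3
    (fun _ => zero_le) fun n => ?_
  have e1 : (fun x => RCLike.re ((μ[F | ℱ n]) x)) =ᵐ[μ] μ[fun x => RCLike.re (F x) | ℱ n] :=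
    RCLike.reCLM.comp_condExp_comm (m := ℱ n) hFint
  have e2 : (fun x => RCLike.im ((μ[F | ℱ n]) x)) =ᵐ[μ] μ[fun x => RCLike.im (F x) | ℱ n] :=
    RCLike.imCLM.comp_condExp_comm (m := ℱ n) hFint
  have m1 : AEStronglyMeasurable (fun x => ‖(μ[fun x => RCLike.re (F x) | ℱ n] - fun x => RCLike.re (F x)) x‖) μ :=
    (integrable_condExp.1.sub hF.re.1).norm
  have m2 : AEStronglyMeasurable (fun x => ‖(μ[fun x => RCLike.im (F x) | ℱ n] - fun x => RCLike.im (F x)) x‖) μ :=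
    (integrable_condExp.1.sub hF.im.1).norm
  refine (eLpNorm_mono_ae_real (g := (fun x => ‖(μ[fun x => RCLike.re (F x) | ℱ n] - fun x => RCLike.re (F x)) x‖) +
    (fun x => ‖(μ[fun x => RCLike.im (F x) | ℱ n] - fun x => RCLike.im (F x)) x‖)) ?_).trans ?_
  · filter_upwards [e1, e2] with x h1 h2
    simp only [Pi.sub_apply, Pi.add_apply]
    rw [← h1, ← h2]
    simpa using Complex.norm_le_abs_re_add_abs_im ((μ[F | ℱ n]) x - F x)
  · refine (eLpNorm_add_le m1 m2 hr).trans_eq ?_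
    rw [eLpNorm_norm, eLpNorm_norm]


/-! ### Summation by parts and Cesàro means in a normed space -/

section Averages

variable {E : Type*} [NormedAddCommGroup E] [NormedSpace ℂ E]

/-- Differences of consecutive terms, with the initial term multiplied by `u`. -/
def twistedDiff (u : ℂ) (e : ℕ → E) : ℕ → E
  | 0 => u • e 0
  | k + 1 => e (k + 1) - e k

/-- The sum of `w ^ (m + 1 - k) • d k` over `k ≤ m`, defined recursively. -/
def geomConv (w : ℂ) (d : ℕ → E) : ℕ → E
  | 0 => w • d 0
  | m + 1 => w • (geomConv w d m + d (m + 1))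

theorem norm_geomConv_le {w : ℂ} (hw : ‖w‖ = 1) (d : ℕ → E) (m : ℕ) :
    ‖geomConv w d m‖ ≤ ∑ k ∈ Finset.range (m + 1), ‖d k‖ := by
  induction m with
  | zero => simp [geomConv, norm_smul, hw]
  | succ m ih =>
    rw [geomConv, norm_smul, hw, one_mul, Finset.sum_range_succ]
    exact (norm_add_le _ _).trans (by gcongr)

/-- The recursion reads `C (m+1) = w C m + w d (m+1)`; summed over `m`, the two sums of `C` differ
only by the boundary terms `C 0` and `C n`. -/
theorem sum_geomConv (w : ℂ) (d : ℕ → E) (n : ℕ) :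
    (1 - w) • ∑ m ∈ Finset.range n, geomConv w d (m + 1) =
      w • (∑ m ∈ Finset.range n, d (m + 1) + geomConv w d 0 - geomConv w d n) := by
  induction n with
  | zero => simp
  | succ n ih =>
    rw [Finset.sum_range_succ, smul_add, ih, Finset.sum_range_succ]
    rw [geomConv.eq_2]
    module

/-- As `|w| = 1`, the powers of `w` do not decay, and the smallness comes from cancellation.
Dividing `sum_geomConv` by `n (1 - w)` leaves a Cesàro mean of `d`, a constant over `n`, and
`geomConv w d n / n`, which is at most a Cesàro mean of the norms `‖d k‖` up to `O(1/n)`. -/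
theorem tendsto_average_geomConv {w : ℂ} (hw : ‖w‖ = 1) (hw1 : w ≠ 1) {d : ℕ → E}
    (hd : Tendsto d atTop (𝓝 0)) :
    Tendsto (fun n : ℕ => (n⁻¹ : ℝ) • ∑ m ∈ Finset.range n, geomConv w d (m + 1)) atTop (𝓝 0) := by
  have hd1 : Tendsto (fun k => d (k + 1)) atTop (𝓝 0) := hd.comp (tendsto_add_atTop_nat 1)
  have h1 : Tendsto (fun n : ℕ => (n⁻¹ : ℝ) • ∑ m ∈ Finset.range n, d (m + 1)) atTop (𝓝 0) :=
    hd1.cesaro_smul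
  have hinv : Tendsto (fun n : ℕ => (n⁻¹ : ℝ)) atTop (𝓝 0) := tendsto_inv_atTop_nhds_zero_nat
  have h2 : Tendsto (fun n : ℕ => (n⁻¹ : ℝ) • geomConv w d 0) atTop (𝓝 0) := by
    simpa using hinv.smul_const (geomConv w d 0)
  have h3 : Tendsto (fun n : ℕ => (n⁻¹ : ℝ) • geomConv w d n) atTop (𝓝 0) := by
    have h4 : Tendsto (fun n : ℕ => (n⁻¹ : ℝ) * ∑ k ∈ Finset.range n, ‖d (k + 1)‖ + (n⁻¹ : ℝ) * ‖d 0‖)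
        atTop (𝓝 0) := by
      have := (tendsto_norm_zero.comp hd1).cesaro.add (hinv.mul_const ‖d 0‖)
      simpa using this
    refine squeeze_zero_norm (fun n => ?_) h4
    rw [norm_smul, ← mul_add, Real.norm_of_nonneg (by positivity)]
    gcongr
    refine (norm_geomConv_le hw d n).trans_eq ?_
    rw [Finset.sum_range_succ']
  have h5 := (((h1.add h2).sub h3).const_smul w).const_smul (1 - w)⁻¹
  simp only [add_zero, sub_zero, smul_zero] at h5
  refine h5.congr fun n => ?_
  have hne : 1 - w ≠ 0 := sub_ne_zero.2 (Ne.symm hw1)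
  rw [← smul_add, ← smul_sub, smul_comm w, ← sum_geomConv, smul_comm (1 - w)⁻¹, smul_smul,
    inv_mul_cancel₀ hne, one_smul]

/-- The coefficients in the expansion of the Poisson transform in conditional expectations. -/
noncomputable def levelCoeff (q : ℕ) (g : ℂ) : ℕ → ℂ
  | 0 => 1
  | j + 1 => g ^ j * ((q * g - 1) / (q + 1))

variable {q : ℕ} {w : ℂ}

/-- Abel summation: beyond index `0` the coefficients are geometric in `w`, so the sum becomes a
convolution of the increments of `e` with powers of `w⁻¹`. The irregular coefficient at `0` is
absorbed by the factor `w (q - w) / (q w - 1)` on `e 0`, the value that makes the case `m = 0`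
exact. -/
theorem sum_levelCoeff_smul (hw0 : w ≠ 0) (hw1 : w ≠ 1) (hq : (q : ℂ) * w ≠ 1) (e : ℕ → E) (m : ℕ) :
    ∑ j ∈ Finset.range (m + 1), levelCoeff q w j • e j =
      ((q * w - 1) / ((q + 1) * (1 - w)) * w ^ m) •
        (geomConv w⁻¹ (twistedDiff (w * (q - w) / (q * w - 1)) e) m - e m) := by
  have h1 : (q : ℂ) + 1 ≠ 0 := by norm_cast
  have h2 : 1 - w ≠ 0 := sub_ne_zero.2 (Ne.symm hw1)
  have h3 : (q : ℂ) * w - 1 ≠ 0 := sub_ne_zero.2 hq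
  induction m with
  | zero =>
    simp only [zero_add, Finset.sum_range_one, levelCoeff, geomConv, twistedDiff]
    match_scalars
    field_simp
    ring
  | succ m ih =>
    rw [Finset.sum_range_succ, ih, levelCoeff, geomConv, twistedDiff]
    match_scalars <;> field_simp <;> ring

/-- For `|w| = 1` the scalar in front is `|c(z)|²` (`norm_cFunction_sq`). The two convolutions are
exchanged by `w ↔ w⁻¹`, under which the factor on `e 0` is inverted. -/
theorem sum_sum_levelCoeff_smul (hw0 : w ≠ 0) (hw1 : w ≠ 1) (hq : (q : ℂ) * w ≠ 1)
    (hq' : (q : ℂ) ≠ w) (e : ℕ → E) (m : ℕ) :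
    ∑ j ∈ Finset.range (m + 1), ∑ k ∈ Finset.range (m + 1),
        (levelCoeff q w⁻¹ j * levelCoeff q w k) • e (min j k) =
      ((q * w - 1) * (q * w⁻¹ - 1) / ((q + 1) ^ 2 * ((1 - w) * (1 - w⁻¹)))) •
        ((2 : ℂ) • e m - geomConv w (twistedDiff (w * (q - w) / (q * w - 1))⁻¹ e) m -
          geomConv w⁻¹ (twistedDiff (w * (q - w) / (q * w - 1)) e) m) := by
  have h1 : (q : ℂ) + 1 ≠ 0 := by norm_cast
  have h2 : 1 - w ≠ 0 := sub_ne_zero.2 (Ne.symm hw1)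
  have h2' : w - 1 ≠ 0 := sub_ne_zero.2 hw1
  have h3 : (q : ℂ) * w - 1 ≠ 0 := sub_ne_zero.2 hq
  have h4 : (q : ℂ) - w ≠ 0 := sub_ne_zero.2 hq'
  have h5 : (q : ℂ) * w⁻¹ ≠ 1 := by
    rw [← div_eq_mul_inv, Ne, div_eq_one_iff_eq hw0]
    exact hq'
  have hu : w⁻¹ * (q - w⁻¹) / (q * w⁻¹ - 1) = (w * (q - w) / (q * w - 1))⁻¹ := by
    field_simp
  induction m with
  | zero =>
    simp only [zero_add, Finset.sum_range_one, levelCoeff, geomConv, twistedDiff, min_self]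
    match_scalars
    field_simp
    ring
  | succ m ih =>
    -- Going from `m` to `m + 1` adds a row and a column. On their off-diagonal entries the minimum
    -- is the index other than `m + 1`, so they are single sums, evaluated by `sum_levelCoeff_smul`
    -- for `w` and for `w⁻¹`.
    have hQ := sum_levelCoeff_smul hw0 hw1 hq e m
    have hQ' := sum_levelCoeff_smul (w := w⁻¹) (inv_ne_zero hw0) (by simpa using hw1) h5 e m
    rw [inv_inv, hu] at hQ'
    have e1 : ∑ j ∈ Finset.range (m + 1), (levelCoeff q w⁻¹ j * levelCoeff q w (m + 1)) •
        e (min j (m + 1)) = levelCoeff q w (m + 1) •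
          ∑ j ∈ Finset.range (m + 1), levelCoeff q w⁻¹ j • e j := by
      rw [Finset.smul_sum]
      refine Finset.sum_congr rfl fun j hj => ?_
      rw [Finset.mem_range] at hj
      rw [min_eq_left (by omega), smul_smul, mul_comm]
    have e2 : ∑ k ∈ Finset.range (m + 1), (levelCoeff q w⁻¹ (m + 1) * levelCoeff q w k) •
        e (min (m + 1) k) = levelCoeff q w⁻¹ (m + 1) •
          ∑ j ∈ Finset.range (m + 1), levelCoeff q w j • e j := by
      rw [Finset.smul_sum]
      refine Finset.sum_congr rfl fun j hj => ?_
      rw [Finset.mem_range] at hj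
      rw [min_eq_right (by omega), smul_smul]
    rw [Finset.sum_range_succ, Finset.sum_range_succ (fun k => (levelCoeff q w⁻¹ (m + 1) *
      levelCoeff q w k) • e (min (m + 1) k)), e2]
    simp only [Finset.sum_range_succ (fun k => (levelCoeff q w⁻¹ _ * levelCoeff q w k) •
      e (min _ k)) (m + 1)]
    rw [Finset.sum_add_distrib, e1, ih, hQ, hQ', min_self]
    simp only [levelCoeff, geomConv, twistedDiff, inv_pow]
    match_scalars <;> field_simp <;> ring

theorem tendsto_average_levelCoeff (hw : ‖w‖ = 1) (hw1 : w ≠ 1) (hq2 : 2 ≤ q) {e : ℕ → E} {f : E}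
    (he : Tendsto e atTop (𝓝 f)) :
    Tendsto (fun n : ℕ => (n : ℂ)⁻¹ • ∑ m ∈ Finset.range n,
      ∑ j ∈ Finset.range (m + 1 + 1), ∑ k ∈ Finset.range (m + 1 + 1),
        (levelCoeff q w⁻¹ j * levelCoeff q w k) • e (min j k)) atTop
      (𝓝 (((q * w - 1) * (q * w⁻¹ - 1) / ((q + 1) ^ 2 * ((1 - w) * (1 - w⁻¹)))) •
        (2 : ℂ) • f)) := by
  have hw0 : w ≠ 0 := by rw [← norm_ne_zero_iff, hw]; exact one_ne_zero
  have hq2' : (2 : ℝ) ≤ q := by exact_mod_cast hq2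
  have hq : (q : ℂ) * w ≠ 1 := by
    intro h
    have := congrArg norm h
    rw [norm_mul, hw, norm_one, Complex.norm_natCast] at this
    linarith
  have hq' : (q : ℂ) ≠ w := by
    intro h
    have := congrArg norm h
    rw [hw, Complex.norm_natCast] at this
    linarith
  have he1 : Tendsto (fun k => e (k + 1)) atTop (𝓝 f) := he.comp (tendsto_add_atTop_nat 1)
  -- The factor `u` affects only the first term, hence not the limit.
  have hd : ∀ u : ℂ, Tendsto (twistedDiff u e) atTop (𝓝 0) := by
    intro u
    rw [← tendsto_add_atTop_iff_nat 1]
    simpa [twistedDiff] using he1.sub he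
  have h1 := tendsto_average_geomConv hw hw1 (hd (w * (q - w) / (q * w - 1))⁻¹)
  have h2 := tendsto_average_geomConv (w := w⁻¹) (by simp [hw]) (by simpa using hw1)
    (hd (w * (q - w) / (q * w - 1)))
  have h3 := ((((he1.const_smul (2 : ℂ)).cesaro_smul).sub h1).sub h2).const_smul
    ((q * w - 1) * (q * w⁻¹ - 1) / ((q + 1) ^ 2 * ((1 - w) * (1 - w⁻¹))))
  rw [sub_zero, sub_zero] at h3
  refine h3.congr fun n => ?_
  have hn : ((n⁻¹ : ℝ) : ℂ) = (n : ℂ)⁻¹ := by push_cast; rfl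
  rw [← hn, Complex.coe_smul]
  simp only [sum_sum_levelCoeff_smul hw0 hw1 hq hq']
  rw [← smul_sub, ← smul_sub, ← Finset.sum_sub_distrib, ← Finset.sum_sub_distrib, ← Finset.smul_sum,
    smul_comm (n⁻¹ : ℝ)]

end Averages


/-! ### Confluence points of two rays -/

section Confluence

variable {X : Type*} {G : SimpleGraph X} {o : X}

/-- A vertex on the geodesic from `o` to `ω_m` lies on `ω`. Induction on the distance to `ω_m`: the
last vertex before `ω_m` on a geodesic from `y` is a parent of `ω_m`, and by uniqueness of parents
it is `ω_{m-1}`. -/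
theorem eq_vertex_of_dist_add_dist (hG : G.IsTree) (ω : Boundary G o) {y : X} {m : ℕ}
    (h : G.dist o y + G.dist y (ω.vertex m) = m) : y = ω.vertex (G.dist o y) := by
  obtain ⟨k, hk⟩ : ∃ k, G.dist y (ω.vertex m) = k := ⟨_, rfl⟩
  induction k generalizing m with
  | zero =>
    have h1 := hG.connected.dist_eq_zero_iff.1 hk
    rw [hk, add_zero] at h
    rw [h, h1]
  | succ k ih =>
    obtain ⟨a, -, hax, hadj, hd⟩ := exists_geodesic hG.connected y (ω.vertex m)
    obtain ⟨n, rfl⟩ : ∃ n, m = n + 1 := ⟨m - 1, by omega⟩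
    rw [hk] at hadj hd hax h
    have h1 := hadj k (by omega)
    rw [hax] at h1
    have h2 := hd k (by omega)
    have h3 := hG.connected.dist_triangle (u := o) (v := y) (w := a k)
    have h4 := hG.connected.dist_triangle (u := o) (v := a k) (w := ω.vertex (n + 1))
    rw [dist_ray, SimpleGraph.dist_eq_one_iff_adj.2 h1] at h4
    have h5 := SimpleGraph.dist_eq_one_iff_adj.1 (ω.geodesic n 1)
    have h6 : a k = ω.vertex n :=
      parent_unique (o := o) hG h1 h5 (by rw [dist_ray]; omega) (by rw [dist_ray, dist_ray])
    rw [h6] at h2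
    exact ih (by omega) h2

/-- Two rays that agree at one level agree at all earlier ones, so the depth of the confluence point
is the last level up to `m` at which they agree. This description is symmetric in `ω` and `ω'`. -/
theorem le_dist_confluence_iff (hG : G.IsTree) (ω ω' : Boundary G o) {m j : ℕ} (hj : j ≤ m) :
    j ≤ G.dist o (confluence (ω.vertex m) ω') ↔ ω'.vertex j = ω.vertex j := by
  have hset : {n : ℕ | G.dist o (ω'.vertex n) + G.dist (ω'.vertex n) (ω.vertex m) =
      G.dist o (ω.vertex m)} = {n | n ≤ m ∧ ω'.vertex n = ω.vertex n} := by
    ext n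
    simp only [Set.mem_ofPred_eq]
    constructor
    · intro h
      rw [dist_ray ω m] at h
      have h1 := eq_vertex_of_dist_add_dist hG ω h
      rw [dist_ray] at h h1
      exact ⟨by omega, h1⟩
    · rintro ⟨h1, h2⟩
      obtain ⟨k, rfl⟩ := Nat.exists_eq_add_of_le h1
      rw [h2, ω.geodesic, dist_ray, dist_ray]
  unfold confluence
  rw [dist_ray, hset]
  have hb : BddAbove {n | n ≤ m ∧ ω'.vertex n = ω.vertex n} := ⟨m, fun n hn => hn.1⟩
  have hne : {n | n ≤ m ∧ ω'.vertex n = ω.vertex n}.Nonempty := ⟨0, by simp [ω.start, ω'.start]⟩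
  constructor
  · intro h
    exact ray_agree hG ω' ω h (Nat.sSup_mem hne hb).2
  · intro h
    exact le_csSup hb ⟨hj, h⟩

theorem dist_confluence_le (ω' : Boundary G o) (x : X) : G.dist o (confluence x ω') ≤ G.dist o x := by
  unfold confluence
  rw [dist_ray]
  refine csSup_le' fun n hn => ?_
  rw [Set.mem_ofPred_eq, dist_ray] at hn
  omega

theorem dist_confluence_comm (hG : G.IsTree) (ω ω' : Boundary G o) (m : ℕ) :
    G.dist o (confluence (ω.vertex m) ω') = G.dist o (confluence (ω'.vertex m) ω) := by
  have h1 := dist_confluence_le ω' (ω.vertex m)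
  have h2 := dist_confluence_le ω (ω'.vertex m)
  rw [dist_ray] at h1 h2
  apply le_antisymm
  · exact (le_dist_confluence_iff hG ω' ω h1).2 ((le_dist_confluence_iff hG ω ω' h1).1 le_rfl).symm
  · exact (le_dist_confluence_iff hG ω ω' h2).2 ((le_dist_confluence_iff hG ω' ω h2).1 le_rfl).symm

theorem poissonKernel_comm (hG : G.IsTree) (q : ℕ) (ω ω' : Boundary G o) (m : ℕ) :
    poissonKernel q (ω.vertex m) ω' = poissonKernel q (ω'.vertex m) ω := by
  unfold poissonKernel
  rw [dist_confluence_comm hG, dist_ray, dist_ray]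

theorem measurableSet_sector (x : X) : MeasurableSet (sector G o x) :=
  MeasurableSpace.measurableSet_generateFrom ⟨x, rfl⟩

end Confluence

/-- The principal branch causes no trouble because the logarithm of a positive real is real. -/
theorem ofReal_zpow_cpow {a : ℝ} (ha : 0 < a) (k : ℤ) (s : ℂ) :
    ((a ^ k : ℝ) : ℂ) ^ s = ((a : ℂ) ^ s) ^ k := by
  have h1 : (a : ℂ) ≠ 0 := by exact_mod_cast ha.ne'
  have h2 : ((a ^ k : ℝ) : ℂ) ≠ 0 := by exact_mod_cast (zpow_pos ha k).ne'
  rw [Complex.cpow_def_of_ne_zero h1, Complex.cpow_def_of_ne_zero h2, ← Complex.exp_int_mul,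
    ← Complex.ofReal_log (zpow_pos ha k).le, Real.log_zpow, ← Complex.ofReal_log ha.le]
  push_cast
  ring_nf

/-! ### Sectors, spheres and the filtration by vertices -/

section Measure

variable {X : Type*} {G : SimpleGraph X} [G.LocallyFinite] {q : ℕ}

instance isProbabilityMeasure_boundaryMeasure (hT : IsHomogeneousTree G q) (o : X) :
    IsProbabilityMeasure (boundaryMeasure hT o) :=
  ⟨by rw [← sector_self hT.isTree.connected o, boundaryMeasure_sector_self]⟩

/-- The measure of a sector of level `j`. -/
noncomputable def levelMass (q : ℕ) : ℕ → ℝ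
  | 0 => 1
  | j + 1 => 1 / ((q + 1) * q ^ j)

theorem levelMass_pos (hq : 0 < q) (j : ℕ) : 0 < levelMass q j := by
  cases j with
  | zero => exact one_pos
  | succ j => rw [levelMass]; positivity

theorem boundaryMeasure_real_sector (hT : IsHomogeneousTree G q) (o x : X) :
    (boundaryMeasure hT o).real (sector G o x) = levelMass q (G.dist o x) := by
  by_cases hx : x = o
  · subst hx
    rw [Measure.real, boundaryMeasure_sector_self, SimpleGraph.dist_self]
    simp [levelMass]
  · have hpos := hT.isTree.connected.pos_dist_of_ne (Ne.symm hx)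
    obtain ⟨n, hn⟩ : ∃ n, G.dist o x = n + 1 := ⟨G.dist o x - 1, by omega⟩
    rw [Measure.real, boundaryMeasure_sector hT o hx, hn]
    simp [levelMass, ENNReal.toReal_add]

/-- A sector of positive measure is nonempty. -/
theorem exists_ray (hT : IsHomogeneousTree G q) (o x : X) :
    ∃ ω : Boundary G o, ω.vertex (G.dist o x) = x := by
  have h1 : (boundaryMeasure hT o).real (sector G o x) ≠ 0 := by
    rw [boundaryMeasure_real_sector]
    exact (levelMass_pos (by have := hT.two_le; omega) _).ne'
  obtain ⟨ω, hω⟩ : (sector G o x).Nonempty := by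
    by_contra h
    rw [Set.not_nonempty_iff_eq_empty] at h
    exact h1 (by simp [h])
  exact ⟨ω, (mem_sector hT.isTree.connected x ω).1 hω⟩

theorem mem_treeBall (hT : IsHomogeneousTree G q) (o x : X) (n : ℕ) :
    x ∈ treeBall hT o n ↔ G.dist o x ≤ n := by
  simp [treeBall]

/-- The set of vertices at distance `m` from `o`. -/
noncomputable def treeSphere (hT : IsHomogeneousTree G q) (o : X) (m : ℕ) : Finset X :=
  (treeBall hT o m).filter (fun x => G.dist o x = m)

theorem mem_treeSphere (hT : IsHomogeneousTree G q) (o x : X) (m : ℕ) :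
    x ∈ treeSphere hT o m ↔ G.dist o x = m := by
  rw [treeSphere, Finset.mem_filter, mem_treeBall]
  omega

theorem sum_treeBall (hT : IsHomogeneousTree G q) (o : X) (n : ℕ) (φ : X → ℂ) :
    ∑ x ∈ treeBall hT o n, φ x = ∑ m ∈ Finset.range (n + 1), ∑ x ∈ treeSphere hT o m, φ x := by
  rw [← Finset.sum_fiberwise_of_maps_to (s := treeBall hT o n) (t := Finset.range (n + 1))
    (g := fun x => G.dist o x)]
  · refine Finset.sum_congr rfl fun m hm => Finset.sum_congr ?_ fun _ _ => rfl
    ext x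
    rw [Finset.mem_range] at hm
    rw [Finset.mem_filter, mem_treeBall, mem_treeSphere]
    omega
  · intro x hx
    rw [mem_treeBall] at hx
    rw [Finset.mem_range]
    omega

theorem comp_vertex_eq_sum (hT : IsHomogeneousTree G q) {o : X} (m : ℕ) (φ : X → ℂ)
    (ω : Boundary G o) :
    φ (ω.vertex m) = ∑ x ∈ treeSphere hT o m, (sector G o x).indicator (fun _ => φ x) ω := by
  rw [Finset.sum_eq_single (ω.vertex m)]
  · rw [Set.indicator_of_mem]
    rw [mem_sector hT.isTree.connected, dist_ray]
  · intro x hx hne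
    rw [mem_treeSphere] at hx
    rw [Set.indicator_of_notMem]
    rw [mem_sector hT.isTree.connected, hx]
    exact hne.symm
  · intro h
    rw [mem_treeSphere, dist_ray] at h
    exact absurd rfl h

/-- Sums over spheres are integrals over the boundary. -/
theorem sum_treeSphere (hT : IsHomogeneousTree G q) (o : X) (m : ℕ) (φ : X → ℂ) :
    ∑ x ∈ treeSphere hT o m, φ x =
      (levelMass q m : ℂ)⁻¹ * ∫ ω, φ (ω.vertex m) ∂(boundaryMeasure hT o) := by
  have h0 : (levelMass q m : ℂ) ≠ 0 := by
    exact_mod_cast (levelMass_pos (by have := hT.two_le; omega) m).ne'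
  rw [eq_inv_mul_iff_mul_eq₀ h0]
  simp_rw [comp_vertex_eq_sum hT m φ]
  rw [integral_finsetSum]
  · rw [Finset.mul_sum]
    refine Finset.sum_congr rfl fun x hx => ?_
    rw [mem_treeSphere] at hx
    rw [integral_indicator_const _ (measurableSet_sector x), boundaryMeasure_real_sector, hx,
      Complex.real_smul]
  · exact fun x _ => (integrable_const _).indicator (measurableSet_sector x)

/-- The filtration of the boundary whose `n`-th σ-algebra is generated by the `n`-th vertex. -/
def rayFiltration (hT : IsHomogeneousTree G q) (o : X) :
    Filtration ℕ (inferInstance : MeasurableSpace (Boundary G o)) where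
  seq n := MeasurableSpace.comap (fun ω => ω.vertex n) ⊤
  mono' := by
    rintro m n hmn _ ⟨A, -, rfl⟩
    -- The `n`-th vertex determines all earlier ones, so an event about `ω_m` is the event that
    -- `ω_n` has an ancestor in `A` at level `m`.
    refine ⟨{x | ∃ ω : Boundary G o, ω.vertex n = x ∧ ω.vertex m ∈ A}, trivial, ?_⟩
    ext ω
    simp only [Set.mem_preimage, Set.mem_ofPred_eq]
    constructor
    · rintro ⟨ω', h1, h2⟩
      rwa [← ray_agree hT.isTree ω' ω hmn h1]
    · exact fun h => ⟨ω, rfl, h⟩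
  le' := by
    classical
    rintro n _ ⟨A, -, rfl⟩
    have h : (fun ω : Boundary G o => ω.vertex n) ⁻¹' A =
        ⋃ x ∈ (treeSphere hT o n).filter (· ∈ A), sector G o x := by
      ext ω
      simp only [Set.mem_preimage, Set.mem_iUnion, Finset.mem_filter, mem_treeSphere,
        mem_sector hT.isTree.connected]
      constructor
      · exact fun h => ⟨ω.vertex n, ⟨dist_ray ω n, h⟩, by rw [dist_ray]⟩
      · rintro ⟨x, ⟨h1, h2⟩, h3⟩
        rw [h1] at h3
        rwa [h3]
    rw [h]
    exact Finset.measurableSet_biUnion _ fun x _ => measurableSet_sector x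

theorem measurableSet_rayFiltration_sector (hT : IsHomogeneousTree G q) (o x : X) :
    MeasurableSet[rayFiltration hT o (G.dist o x)] (sector G o x) :=
  ⟨{x}, trivial, by ext ω; rw [mem_sector hT.isTree.connected]; rfl⟩

theorem iSup_rayFiltration (hT : IsHomogeneousTree G q) (o : X) :
    ⨆ n, rayFiltration hT o n = (inferInstance : MeasurableSpace (Boundary G o)) := by
  apply le_antisymm (iSup_le fun n => (rayFiltration hT o).le n)
  apply MeasurableSpace.generateFrom_le
  rintro _ ⟨x, rfl⟩
  exact le_iSup (fun n => rayFiltration hT o n) _ _ (measurableSet_rayFiltration_sector hT o x)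

/-- The conditional expectations along the ray filtration are averages over sectors. -/
theorem setIntegral_sector_vertex (hT : IsHomogeneousTree G q) {o : X} {F : Boundary G o → ℂ}
    (hF : Integrable F (boundaryMeasure hT o)) (j : ℕ) (ω : Boundary G o) :
    ∫ ω' in sector G o (ω.vertex j), F ω' ∂(boundaryMeasure hT o) =
      levelMass q j * ((boundaryMeasure hT o)[F | rayFiltration hT o j]) ω := by
  have hms : MeasurableSet[rayFiltration hT o j] (sector G o (ω.vertex j)) := by
    have := measurableSet_rayFiltration_sector hT o (ω.vertex j)
    rwa [dist_ray] at this
  rw [← setIntegral_condExp ((rayFiltration hT o).le j) hF hms]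
  -- The conditional expectation is a function of `ω_j` alone, hence constant on the sector, and its
  -- integral is that constant times the mass.
  have hfac : Function.FactorsThrough ((boundaryMeasure hT o)[F | rayFiltration hT o j])
      (fun ω : Boundary G o => ω.vertex j) :=
    StronglyMeasurable.factorsThrough (mY := ⊤) stronglyMeasurable_condExp
  rw [setIntegral_congr_fun (g := fun _ => ((boundaryMeasure hT o)[F | rayFiltration hT o j]) ω)
    (measurableSet_sector _), setIntegral_const, boundaryMeasure_real_sector, dist_ray,
    Complex.real_smul]
  intro ω' hω'
  rw [mem_sector hT.isTree.connected, dist_ray] at hω'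
  exact hfac hω'

end Measure


/-! ### Expansion of the Poisson kernel in sector indicators -/

/-- Telescoping: `levelCoeff` is defined so that its quotient by `levelMass` at `j + 1` is `(q
g)^(j+1) - (q g)^j`. -/
theorem pow_two_mul_eq_sum_levelCoeff {q : ℕ} (hq : 0 < q) {h g : ℂ} (hg : h ^ 2 = q * g)
    {c m : ℕ} (hc : c ≤ m) :
    h ^ (2 * c) = ∑ j ∈ Finset.range (m + 1),
      if j ≤ c then levelCoeff q g j * (levelMass q j : ℂ)⁻¹ else 0 := by
  have hq0 : (q : ℂ) ≠ 0 := by exact_mod_cast hq.ne'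
  have hq1 : (q : ℂ) + 1 ≠ 0 := by norm_cast
  rw [← Finset.sum_filter, show (Finset.range (m + 1)).filter (· ≤ c) = Finset.range (c + 1) by
    ext j; simp only [Finset.mem_filter, Finset.mem_range]; omega, pow_mul, hg]
  clear hc
  induction c with
  | zero => simp [levelCoeff, levelMass]
  | succ c ih =>
    rw [Finset.sum_range_succ, ← ih, levelCoeff, levelMass]
    push_cast
    rw [mul_pow, mul_pow]
    field_simp
    ring

section Expansion

variable {X : Type*} {G : SimpleGraph X} [G.LocallyFinite] {q : ℕ}

open Classical in
theorem poissonKernel_cpow_vertex (hT : IsHomogeneousTree G q) {o : X} {s g : ℂ}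
    (hg : ((q : ℂ) ^ s) ^ 2 = q * g) (m : ℕ) (ω ω' : Boundary G o) :
    (poissonKernel q (ω.vertex m) ω' : ℂ) ^ s = (((q : ℂ) ^ s) ^ m)⁻¹ *
      ∑ j ∈ Finset.range (m + 1), levelCoeff q g j * (levelMass q j : ℂ)⁻¹ *
        (sector G o (ω.vertex j)).indicator 1 ω' := by
  have hq : 0 < q := by have := hT.two_le; omega
  have hq0 : (q : ℂ) ≠ 0 := by exact_mod_cast hq.ne'
  have hh : (q : ℂ) ^ s ≠ 0 := by simp [Complex.cpow_eq_zero_iff, hq0]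
  have hc := dist_confluence_le ω' (ω.vertex m)
  rw [dist_ray] at hc
  have h1 : (poissonKernel q (ω.vertex m) ω' : ℂ) ^ s = (((q : ℂ) ^ s) ^ m)⁻¹ *
      ((q : ℂ) ^ s) ^ (2 * G.dist o (confluence (ω.vertex m) ω')) := by
    rw [poissonKernel, ofReal_zpow_cpow (by exact_mod_cast hq), dist_ray, zpow_sub₀ (by simpa using hh),
      div_eq_inv_mul]
    norm_cast
  rw [h1, pow_two_mul_eq_sum_levelCoeff hq hg hc]
  congr 1
  refine Finset.sum_congr rfl fun j hj => ?_
  rw [Finset.mem_range] at hj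
  simp only [le_dist_confluence_iff hT.isTree ω ω' (show j ≤ m by omega), Set.indicator_apply,
    mem_sector hT.isTree.connected, dist_ray, Pi.one_apply, mul_ite, mul_one, mul_zero]

theorem poissonKernel_cpow_mul_eq (hT : IsHomogeneousTree G q) {o : X} {s g : ℂ}
    (hg : ((q : ℂ) ^ s) ^ 2 = q * g) (F : Boundary G o → ℂ) (m : ℕ) (ω ω' : Boundary G o) :
    (poissonKernel q (ω.vertex m) ω' : ℂ) ^ s * F ω' = (((q : ℂ) ^ s) ^ m)⁻¹ *
      ∑ j ∈ Finset.range (m + 1), levelCoeff q g j * (levelMass q j : ℂ)⁻¹ *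
        (sector G o (ω.vertex j)).indicator F ω' := by
  rw [poissonKernel_cpow_vertex hT hg, mul_assoc, Finset.sum_mul]
  congr 1
  refine Finset.sum_congr rfl fun j _ => ?_
  rw [mul_assoc]
  congr 1
  by_cases h : ω' ∈ sector G o (ω.vertex j) <;> simp [h]

theorem integrable_poissonKernel_cpow_mul (hT : IsHomogeneousTree G q) {o : X} (s : ℂ)
    {F : Boundary G o → ℂ} (hF : Integrable F (boundaryMeasure hT o)) (x : X) :
    Integrable (fun ω => (poissonKernel q x ω : ℂ) ^ s * F ω) (boundaryMeasure hT o) := by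
  have hq0 : (q : ℂ) ≠ 0 := by have := hT.two_le; norm_cast; omega
  obtain ⟨ω, hω⟩ := exists_ray hT o x
  -- For a general exponent `s`, `g` is simply `q^{2s} / q`; every vertex lies on a ray, so the
  -- expansion along rays covers all `x`.
  have hg : ((q : ℂ) ^ s) ^ 2 = q * (((q : ℂ) ^ s) ^ 2 / q) := by field_simp
  rw [← hω]
  simp_rw [poissonKernel_cpow_mul_eq hT hg]
  exact (integrable_finsetSum _ fun j _ =>
    (hF.indicator (measurableSet_sector _)).const_mul _).const_mul _

/-- The Poisson integral along a ray in terms of conditional expectations. -/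
theorem integral_poissonKernel_cpow_mul (hT : IsHomogeneousTree G q) {o : X} {s g : ℂ}
    (hg : ((q : ℂ) ^ s) ^ 2 = q * g) {F : Boundary G o → ℂ}
    (hF : Integrable F (boundaryMeasure hT o)) (m : ℕ) (ω : Boundary G o) :
    ∫ ω', (poissonKernel q (ω.vertex m) ω' : ℂ) ^ s * F ω' ∂(boundaryMeasure hT o) =
      (((q : ℂ) ^ s) ^ m)⁻¹ * ∑ j ∈ Finset.range (m + 1),
        levelCoeff q g j * ((boundaryMeasure hT o)[F | rayFiltration hT o j]) ω := by
  simp_rw [poissonKernel_cpow_mul_eq hT hg]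
  rw [integral_const_mul, integral_finsetSum]
  · congr 1
    refine Finset.sum_congr rfl fun j _ => ?_
    have h0 : (levelMass q j : ℂ) ≠ 0 := by
      exact_mod_cast (levelMass_pos (by have := hT.two_le; omega) j).ne'
    rw [integral_const_mul, integral_indicator (measurableSet_sector _),
      setIntegral_sector_vertex hT hF]
    field_simp
  · exact fun j _ => (hF.indicator (measurableSet_sector _)).const_mul _

theorem condExp_condExp_min {Ω : Type*} {m0 : MeasurableSpace Ω} {μ : Measure Ω}
    [IsFiniteMeasure μ] (ℱ : Filtration ℕ m0) (F : Ω → ℂ) (j k : ℕ) :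
    μ[μ[F | ℱ k] | ℱ j] =ᵐ[μ] μ[F | ℱ (min j k)] := by
  rcases le_total j k with h | h
  · rw [min_eq_left h]
    exact condExp_condExp_of_le (ℱ.mono h) (ℱ.le k)
  · rw [min_eq_right h, condExp_of_stronglyMeasurable (ℱ.le j)
      (stronglyMeasurable_condExp.mono (ℱ.mono h)) integrable_condExp]

/-- With `s + s' = 1` the two prefactors multiply to `q^{-m}`. The equality is only almost
everywhere because the tower property is. -/
theorem sum_treeSphere_poisson (hT : IsHomogeneousTree G q) {o : X} {s s' g g' : ℂ}
    (hss : s + s' = 1)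
    (hg : ((q : ℂ) ^ s) ^ 2 = q * g) (hg' : ((q : ℂ) ^ s') ^ 2 = q * g') {F : Boundary G o → ℂ}
    (hF : Integrable F (boundaryMeasure hT o)) (m : ℕ) :
    (fun ω => ∑ x ∈ treeSphere hT o m, (poissonKernel q x ω : ℂ) ^ s' *
        ∫ ω', (poissonKernel q x ω' : ℂ) ^ s * F ω' ∂(boundaryMeasure hT o))
      =ᵐ[boundaryMeasure hT o] fun ω => ((levelMass q m : ℂ) * (q : ℂ) ^ m)⁻¹ *
        ∑ j ∈ Finset.range (m + 1), ∑ k ∈ Finset.range (m + 1),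
          (levelCoeff q g' j * levelCoeff q g k) *
            ((boundaryMeasure hT o)[F | rayFiltration hT o (min j k)]) ω := by
  have hq0 : (q : ℂ) ≠ 0 := by have := hT.two_le; norm_cast; omega
  have hpow : (((q : ℂ) ^ s') ^ m)⁻¹ * (((q : ℂ) ^ s) ^ m)⁻¹ = ((q : ℂ) ^ m)⁻¹ := by
    rw [← mul_inv, ← mul_pow, ← Complex.cpow_add _ _ hq0, add_comm, hss, Complex.cpow_one]
  set Q : Boundary G o → ℂ := ∑ k ∈ Finset.range (m + 1),
    levelCoeff q g k • (boundaryMeasure hT o)[F | rayFiltration hT o k] with hQ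
  have hQint : Integrable Q (boundaryMeasure hT o) :=
    integrable_finsetSum' _ fun k _ => integrable_condExp.smul _
  have hcond : ∀ j, (boundaryMeasure hT o)[Q | rayFiltration hT o j] =ᵐ[boundaryMeasure hT o]
      fun ω => ∑ k ∈ Finset.range (m + 1), levelCoeff q g k *
        ((boundaryMeasure hT o)[F | rayFiltration hT o (min j k)]) ω := by
    intro j
    have h1 := condExp_finsetSum (μ := boundaryMeasure hT o) (s := Finset.range (m + 1))
      (f := fun k => levelCoeff q g k • (boundaryMeasure hT o)[F | rayFiltration hT o k])
      (fun k _ => integrable_condExp.smul _) (rayFiltration hT o j)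
    have h2 : ∀ᵐ ω ∂(boundaryMeasure hT o), ∀ k,
        ((boundaryMeasure hT o)[levelCoeff q g k • (boundaryMeasure hT o)[F | rayFiltration hT o k] |
          rayFiltration hT o j]) ω = levelCoeff q g k *
          ((boundaryMeasure hT o)[F | rayFiltration hT o (min j k)]) ω := by
      rw [ae_all_iff]
      intro k
      filter_upwards [condExp_smul (μ := boundaryMeasure hT o) (levelCoeff q g k)
        ((boundaryMeasure hT o)[F | rayFiltration hT o k]) (rayFiltration hT o j),
        condExp_condExp_min (μ := boundaryMeasure hT o) (rayFiltration hT o) F j k] with ω h3 h4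
      rw [h3, Pi.smul_apply, h4, smul_eq_mul]
    filter_upwards [h1, h2] with ω h3 h4
    rw [hQ, h3, Finset.sum_apply]
    exact Finset.sum_congr rfl fun k _ => h4 k
  have hall := ae_all_iff.2 hcond
  filter_upwards [hall] with ω hω
  rw [sum_treeSphere]
  -- By symmetry of the kernel the base vertex moves from `ω'` to `ω`, so the integral over `ω'` is
  -- the Poisson integral of `Q` at `ω_m`.
  have e1 : ∀ ω' : Boundary G o, (poissonKernel q (ω'.vertex m) ω : ℂ) ^ s' *
      ∫ ω'', (poissonKernel q (ω'.vertex m) ω'' : ℂ) ^ s * F ω'' ∂(boundaryMeasure hT o) =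
      (((q : ℂ) ^ s) ^ m)⁻¹ * ((poissonKernel q (ω.vertex m) ω' : ℂ) ^ s' * Q ω') := by
    intro ω'
    rw [poissonKernel_comm hT.isTree, integral_poissonKernel_cpow_mul hT hg hF, hQ,
      Finset.sum_apply]
    simp only [Pi.smul_apply, smul_eq_mul]
    ring
  simp_rw [e1]
  rw [integral_const_mul, integral_poissonKernel_cpow_mul hT hg' hQint, mul_inv, ← hpow]
  simp_rw [hω, Finset.mul_sum]
  refine Finset.sum_congr rfl fun j _ => Finset.sum_congr rfl fun k _ => ?_
  ring

end Expansion


/-! ### Powers of `q` and the modulus of the `c`-function -/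

theorem natCast_cpow_half_sq (q : ℕ) : ((q : ℂ) ^ (1 / 2 : ℂ)) ^ 2 = q := by
  rw [← Complex.cpow_nat_mul]
  norm_num

theorem natCast_cpow_half_add_sq {q : ℕ} (hq : q ≠ 0) (z : ℂ) :
    ((q : ℂ) ^ (1 / 2 + Complex.I * z)) ^ 2 = q * ((q : ℂ) ^ (Complex.I * z)) ^ 2 := by
  rw [Complex.cpow_add _ _ (by exact_mod_cast hq), mul_pow, natCast_cpow_half_sq]

theorem natCast_cpow_half_sub_sq {q : ℕ} (hq : q ≠ 0) (z : ℂ) :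
    ((q : ℂ) ^ (1 / 2 - Complex.I * z)) ^ 2 = q * (((q : ℂ) ^ (Complex.I * z)) ^ 2)⁻¹ := by
  rw [Complex.cpow_sub _ _ (by exact_mod_cast hq), div_pow, natCast_cpow_half_sq, div_eq_mul_inv]

theorem norm_natCast_cpow_I_mul {q : ℕ} (hq : 0 < q) (z : ℝ) :
    ‖(q : ℂ) ^ (Complex.I * z)‖ = 1 := by
  rw [Complex.norm_natCast_cpow_of_pos hq]
  simp

/-- `q^{2iz} = 1` means `2 z log q ∈ 2πℤ`, that is `z ∈ (τ/2)ℤ`. -/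
theorem natCast_cpow_I_mul_sq_ne_one {q : ℕ} (hq : 2 ≤ q) {z : ℝ}
    (hz : ∀ k : ℤ, z ≠ period q / 2 * k) : ((q : ℂ) ^ (Complex.I * z)) ^ 2 ≠ 1 := by
  intro h
  have hlog : Real.log q ≠ 0 := (Real.log_pos (by exact_mod_cast hq)).ne'
  rw [Complex.cpow_def_of_ne_zero (by norm_cast; omega), ← Complex.exp_nat_mul,
    Complex.exp_eq_one_iff] at h
  obtain ⟨n, hn⟩ := h
  rw [← Complex.natCast_log] at hn
  have h1 : ((2 * (Real.log q * z) : ℝ) : ℂ) * Complex.I = ((n * (2 * Real.pi) : ℝ) : ℂ) * Complex.I := by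
    push_cast at hn ⊢
    linear_combination hn
  have h2 := Complex.ofReal_injective (mul_right_cancel₀ Complex.I_ne_zero h1)
  apply hz n
  rw [period]
  field_simp
  linear_combination h2 / 2

theorem cFunction_eq {q : ℕ} (hq : q ≠ 0) (z : ℂ) :
    cFunction q z = (q * ((q : ℂ) ^ (Complex.I * z)) ^ 2 - 1) /
      ((q + 1) * (((q : ℂ) ^ (Complex.I * z)) ^ 2 - 1)) := by
  have hq0 : (q : ℂ) ≠ 0 := by exact_mod_cast hq
  have hq1 : (q : ℂ) + 1 ≠ 0 := by norm_cast
  have ht : (q : ℂ) ^ (Complex.I * z) ≠ 0 := by simp [Complex.cpow_eq_zero_iff, hq0]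
  have hh : (q : ℂ) ^ (1 / 2 : ℂ) ≠ 0 := by simp [Complex.cpow_eq_zero_iff, hq0]
  have hs := natCast_cpow_half_sq q
  rw [cFunction, show -(1 / 2 : ℂ) - Complex.I * z = -(1 / 2 + Complex.I * z) by ring,
    Complex.cpow_neg, Complex.cpow_neg, Complex.cpow_add _ _ hq0]
  generalize (q : ℂ) ^ (Complex.I * z) = t at *
  generalize (q : ℂ) ^ (1 / 2 : ℂ) = h at *
  have e : t - t⁻¹ = (t ^ 2 - 1) / t := by field_simp
  rw [e, ← hs]
  -- At the poles both sides are `0` by the convention for division by zero.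
  rcases eq_or_ne (t ^ 2 - 1) 0 with h0 | h0
  · simp [h0]
  · rw [← hs] at hq1
    field_simp

/-- On the unit circle conjugation replaces `w` by `w⁻¹`, so `|c|²` is a rational function of `w`.
-/
theorem norm_cFunction_sq {q : ℕ} (hq : q ≠ 0) (z : ℝ) {w : ℂ}
    (hw : w = ((q : ℂ) ^ (Complex.I * z)) ^ 2) :
    (‖cFunction q z‖ : ℂ) ^ 2 =
      (q * w - 1) * (q * w⁻¹ - 1) / ((q + 1) ^ 2 * ((1 - w) * (1 - w⁻¹))) := by
  have hn : ‖w‖ = 1 := by rw [hw, norm_pow, norm_natCast_cpow_I_mul (by omega), one_pow]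
  rw [← Complex.mul_conj', cFunction_eq hq, ← hw, Complex.inv_eq_conj hn]
  simp only [map_div₀, map_mul, map_sub, map_add, map_one, Complex.conj_natCast]
  rw [div_mul_div_comm]
  congr 1
  ring

/-! ### The averages as elements of `L^r` and the limit -/

section Limit

variable {X : Type*} {G : SimpleGraph X} [G.LocallyFinite] {q : ℕ}

theorem coeFn_sum_smul {Ω ι : Type*} [MeasurableSpace Ω] {μ : Measure Ω} {r : ENNReal}
    (s : Finset ι) (c : ι → ℂ) (f : ι → Lp ℂ r μ) :
    ⇑(∑ i ∈ s, c i • f i) =ᵐ[μ] fun ω => ∑ i ∈ s, c i * f i ω := by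
  classical
  induction s using Finset.induction_on with
  | empty =>
    simp only [Finset.sum_empty]
    exact Lp.coeFn_zero ℂ r μ
  | insert a s ha ih =>
    rw [Finset.sum_insert ha]
    filter_upwards [ih, Lp.coeFn_add (c a • f a) (∑ i ∈ s, c i • f i),
      Lp.coeFn_smul (c a) (f a)] with ω h1 h2 h3
    rw [h2, Pi.add_apply, h1, h3, Finset.sum_insert ha, Pi.smul_apply, smul_eq_mul]

/-- Transfers the pointwise expansion to the Banach space `Lp`, where the Cesàro argument applies.
The term `e 0` is the sphere of radius `0`, which is separate because the normalisation `(levelMass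
q m * q^m)⁻¹` is `1` there and `(q+1)/q` at every positive radius. -/
theorem poissonAverage_ae_eq (hT : IsHomogeneousTree G q) {o : X} (z : ℂ) {w : ℂ}
    (hw : w = ((q : ℂ) ^ (Complex.I * z)) ^ 2) {r : ENNReal}
    {F : Boundary G o → ℂ} (hF : Integrable F (boundaryMeasure hT o))
    (e : ℕ → Lp ℂ r (boundaryMeasure hT o))
    (he : ∀ k, e k =ᵐ[boundaryMeasure hT o] (boundaryMeasure hT o)[F | rayFiltration hT o k])
    (n : ℕ) :
    poissonAverage hT z F n =ᵐ[boundaryMeasure hT o]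
      ⇑((n : ℂ)⁻¹ • e 0 + ((q + 1) / q : ℂ) • (n : ℂ)⁻¹ • ∑ m ∈ Finset.range n,
        ∑ j ∈ Finset.range (m + 1 + 1), ∑ k ∈ Finset.range (m + 1 + 1),
          (levelCoeff q w⁻¹ j * levelCoeff q w k) • e (min j k)) := by
  have hq : q ≠ 0 := by have := hT.two_le; omega
  have hq0 : (q : ℂ) ≠ 0 := by exact_mod_cast hq
  have hq1 : (q : ℂ) + 1 ≠ 0 := by norm_cast
  have hg := natCast_cpow_half_add_sq hq z
  have hg' := natCast_cpow_half_sub_sq hq z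
  rw [← hw] at hg hg'
  have hS := ae_all_iff.2 fun m => sum_treeSphere_poisson hT (by ring) hg hg' hF m
  have hU := ae_all_iff.2 fun m => coeFn_sum_smul (Finset.range (m + 1) ×ˢ Finset.range (m + 1))
    (fun p : ℕ × ℕ => levelCoeff q w⁻¹ p.1 * levelCoeff q w p.2) (fun p => e (min p.1 p.2))
  have hsum := coeFn_sum_smul (Finset.range n) (fun _ => (1 : ℂ)) fun m =>
    ∑ p ∈ Finset.range (m + 1 + 1) ×ˢ Finset.range (m + 1 + 1),
      (levelCoeff q w⁻¹ p.1 * levelCoeff q w p.2) • e (min p.1 p.2)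
  simp only [one_smul] at hsum
  simp only [← Finset.sum_product']
  have hadd := Lp.coeFn_add ((n : ℂ)⁻¹ • e 0) (((q + 1) / q : ℂ) • (n : ℂ)⁻¹ •
    ∑ m ∈ Finset.range n, ∑ p ∈ Finset.range (m + 1 + 1) ×ˢ Finset.range (m + 1 + 1),
      (levelCoeff q w⁻¹ p.1 * levelCoeff q w p.2) • e (min p.1 p.2))
  have hs0 := Lp.coeFn_smul (n : ℂ)⁻¹ (e 0)
  have hs1 := Lp.coeFn_smul ((q + 1) / q : ℂ) ((n : ℂ)⁻¹ •
    ∑ m ∈ Finset.range n, ∑ p ∈ Finset.range (m + 1 + 1) ×ˢ Finset.range (m + 1 + 1),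
      (levelCoeff q w⁻¹ p.1 * levelCoeff q w p.2) • e (min p.1 p.2))
  have hs2 := Lp.coeFn_smul (n : ℂ)⁻¹
    (∑ m ∈ Finset.range n, ∑ p ∈ Finset.range (m + 1 + 1) ×ˢ Finset.range (m + 1 + 1),
      (levelCoeff q w⁻¹ p.1 * levelCoeff q w p.2) • e (min p.1 p.2))
  filter_upwards [hS, hU, ae_all_iff.2 he, hsum, hadd, hs0, hs1, hs2] with
    ω hS hU he hsum hadd hs0 hs1 hs2
  rw [hadd, Pi.add_apply, hs0, hs1, Pi.smul_apply, Pi.smul_apply, hs2, Pi.smul_apply, hsum]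
  simp only [smul_eq_mul, one_mul, hU, he]
  unfold poissonAverage poissonTransform
  rw [sum_treeBall, Finset.sum_congr rfl fun m _ => hS m, Finset.sum_range_succ']
  have e0 : ∀ m, ((levelMass q (m + 1) : ℂ) * (q : ℂ) ^ (m + 1))⁻¹ = (q + 1) / q := by
    intro m
    rw [levelMass]
    push_cast
    field_simp
    ring
  have e1 : ∀ g : ℂ, levelCoeff q g 0 = 1 := fun _ => rfl
  have e2 : levelMass q 0 = 1 := rfl
  simp only [e0, e1, e2, ← Finset.mul_sum, Finset.sum_product, zero_add, Finset.sum_range_one,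
    min_self, pow_zero, Complex.ofReal_one]
  ring

end Limit

end HomTree

theorem mainTheorem3 {X : Type*} (G : SimpleGraph X) [G.LocallyFinite] {q : ℕ}
    (hT : HomTree.IsHomogeneousTree G q) (o : X)
    (z : ℝ) (hz : ∀ k : ℤ, z ≠ HomTree.period q / 2 * k)
    (r : ENNReal) (hr : 1 < r) (hr' : r < ⊤)
    (F : HomTree.Boundary G o → ℂ) (hF : MemLp F r (HomTree.boundaryMeasure hT o)) :
    (∀ x : X, Integrable
      (fun ω => (HomTree.poissonKernel q x ω : ℂ) ^ (1 / 2 + Complex.I * (z : ℂ)) * F ω)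
      (HomTree.boundaryMeasure hT o)) ∧
    (∀ n : ℕ, MemLp (HomTree.poissonAverage hT z F n) r (HomTree.boundaryMeasure hT o)) ∧
    Tendsto
      (fun n : ℕ => eLpNorm
        (fun ω => (q : ℂ) / (2 * ((q : ℂ) + 1) * (‖HomTree.cFunction q z‖ : ℂ) ^ 2) *
          HomTree.poissonAverage hT z F n ω - F ω)
        r (HomTree.boundaryMeasure hT o))
      atTop (𝓝 0) := by
  open HomTree in
  have hFint : Integrable F (boundaryMeasure hT o) := hF.integrable hr.le
  have : Fact (1 ≤ r) := ⟨hr.le⟩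
  have hq2 := hT.two_le
  have hq : q ≠ 0 := by omega
  have hq0 : (q : ℂ) ≠ 0 := by exact_mod_cast hq
  have hq1 : (q : ℂ) + 1 ≠ 0 := by norm_cast
  obtain ⟨w, hw⟩ : ∃ w : ℂ, w = ((q : ℂ) ^ (Complex.I * z)) ^ 2 := ⟨_, rfl⟩
  have hwn : ‖w‖ = 1 := by rw [hw, norm_pow, norm_natCast_cpow_I_mul (by omega), one_pow]
  have hw1 : w ≠ 1 := by rw [hw]; exact natCast_cpow_I_mul_sq_ne_one hq2 hz
  have hc := norm_cFunction_sq hq z hw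
  -- The numerator `q w - 1` cannot vanish because `|q w| = q ≥ 2`.
  have hc0 : (‖cFunction q z‖ : ℂ) ≠ 0 := by
    rw [Complex.ofReal_ne_zero, norm_ne_zero_iff, cFunction_eq hq, ← hw]
    refine div_ne_zero (fun h => ?_) (mul_ne_zero hq1 (sub_ne_zero.2 hw1))
    have h1 := congrArg norm (sub_eq_zero.1 h)
    rw [norm_mul, hwn, norm_one, Complex.norm_natCast, mul_one] at h1
    norm_cast at h1
    omega
  have hm : ∀ k, MemLp ((boundaryMeasure hT o)[F | rayFiltration hT o k]) r (boundaryMeasure hT o) :=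
    fun k => hF.condExp hr.le
  have he : Tendsto (fun k => (hm k).toLp) atTop (𝓝 hF.toLp) := by
    rw [Lp.tendsto_Lp_iff_tendsto_eLpNorm'']
    exact tendsto_eLpNorm_condExp_sub (rayFiltration hT o) (iSup_rayFiltration hT o) hr.le
      hr'.ne hF
  have hae := poissonAverage_ae_eq hT z hw hFint _ (fun k => (hm k).coeFn_toLp)
  have hlim := tendsto_average_levelCoeff hwn hw1 hq2 he
  have hinv : Tendsto (fun n : ℕ => (n : ℂ)⁻¹) atTop (𝓝 0) := tendsto_inv_atTop_nhds_zero_nat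
  have hlim2 := (((hinv.smul_const (hm 0).toLp)).add
    (hlim.const_smul ((q + 1) / q : ℂ))).const_smul
    ((q : ℂ) / (2 * ((q : ℂ) + 1) * (‖cFunction q z‖ : ℂ) ^ 2))
  -- The normalising constant cancels the sphere factor `(q+1)/q` and the limit factor `2 |c(z)|²`;
  -- the contribution of the origin is `O(1/n)`.
  rw [← hc, zero_smul, zero_add, smul_smul, smul_smul, smul_smul,
    show (q : ℂ) / (2 * ((q : ℂ) + 1) * (‖cFunction q z‖ : ℂ) ^ 2) *
      ((q + 1) / q) * (‖cFunction q z‖ : ℂ) ^ 2 * 2 = 1 by field_simp, one_smul,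
    Lp.tendsto_Lp_iff_tendsto_eLpNorm] at hlim2
  refine ⟨fun x => integrable_poissonKernel_cpow_mul hT _ hFint x,
    fun n => (memLp_congr_ae (hae n)).2 (Lp.memLp _), hlim2.congr fun n => eLpNorm_congr_ae ?_⟩
  filter_upwards [hae n, Lp.coeFn_smul ((q : ℂ) / (2 * ((q : ℂ) + 1) * (‖cFunction q z‖ : ℂ) ^ 2))
    ((n : ℂ)⁻¹ • (hm 0).toLp + ((q + 1) / q : ℂ) • (n : ℂ)⁻¹ • ∑ m ∈ Finset.range n,
        ∑ j ∈ Finset.range (m + 1 + 1), ∑ k ∈ Finset.range (m + 1 + 1),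
          (levelCoeff q w⁻¹ j * levelCoeff q w k) • (hm (min j k)).toLp)] with ω h1 h2
  rw [Pi.sub_apply, h2, Pi.smul_apply, h1, smul_eq_mul]
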